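/- An algebra of type $\langle 2,2,1\rangle$ is a nonempty set $A$ with operations $\wedge,\vee$ (binary) and $\lnot$ (unary). A \emph{De Morgan bisemilattice} is such an algebra in which $\wedge$ and $\vee$ are semilattice operations that distribute over each other, and $\lnot\lnot x\approx x$, $\lnot(x\wedge y)\approx\lnot x\vee\lnot y$, $\lnot(x\vee y)\approx\lnot x\wedge\lnot y$ hold; it is a \emph{De Morgan lattice} if in addition $\langle A,\wedge,\vee\rangle$ is a (distributive) lattice. Let $\mathcal{DML}$ be the class of De Morgan lattices, and let $\mathcal{RBDMBL}$ be the class of \emph{regular bipolarly absorptive} De Morgan bisemilattices, i.e. those satisfying $$x\wedge(x\vee\lnot x)\wedge(x\vee\lnot x\vee y)\approx x\wedge(x\vee\lnot x)\wedge(x\vee\lnot x\vee\lnot y).$$ For a term $\varphi$ let $Var(\varphi)$, $Var^+(\varphi)$, $Var^-(\varphi)$ be the sets of variables that occur in $\varphi$, respectively occur in the scope of an even, an odd, number of negations. An identity $\varphi\approx\psi$ is \emph{regular bipolarly balanced} if either $Var(\varphi)=Var(\psi)$, $Var^+(\varphi)\cap Var^-(\varphi)\ne\emptyset$ and $Var^+(\psi)\cap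 Var^-(\psi)\neq\emptyset$, or else $Var^+(\varphi)=Var^+(\psi)$ and $Var^-(\varphi)=Var^-(\psi)$. Let $R(Bip(\mathcal{DML}))$ be the class of algebras of type $\langle 2,2,1\rangle$ satisfying all regular bipolarly balanced identities valid in $\mathcal{DML}$. An \emph{involutive semilattice} is an algebra $\langle I,\vee,\lnot\rangle$ of type $\langle2,1\rangle$ such that $\langle I,\vee\rangle$ is a semilattice, $\lnot\lnot x\approx x$ and $\lnot(x\vee y)\approx\lnot x\vee\lnot y$; it is ordered by $i\le j\iff i\vee j=j$, and it is also viewed as an algebra of type $\langle2,2,1\rangle$ by putting $x\wedge y:=x\vee y$. Let $\mathbf{IS}_2$ be the chain $i<j$ with $\lnot i=i$, $\lnot j=j$; let $\mathbf{IS}_3$ have the elements $i,\lnot i,j$, where $i\neq\lnot i$, $\lnot j=j$, and the join of any two distinct elements is $j$; and let $\mathbf{DM}_4$ be the De Morgan lattice on the four-element lattice with bottom $f$, top $t$ and two incomparable elements, where $\lnot$ exchanges $f$ and $t$ and fixes the other two. For a class $\mathcal K$ of algebras of the same type, $V(\mathcal K)$ is the variety generated by $\mathcal K$, i.e. the class of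 homomorphic images of subalgebras of direct products of members of $\mathcal K$. An \emph{involutive semilattice direct system of distributive lattices} over an involutive semilattice $\mathbf I$ consists of a nonempty distributive lattice $F(i)$ for each $i\in I$; lattice homomorphisms $p_{ij}:F(i)\to F(j)$ for $i\le j$ with $p_{ii}=\mathrm{id}$ and $p_{jk}\circ p_{ij}=p_{ik}$; and isomorphisms $n_i$ from $F(i)$ onto the order dual of $F(\lnot i)$ with $n_{\lnot i}\circ n_i=\mathrm{id}$ and $n_j\circ p_{ij}=p_{\lnot i\,\lnot j}\circ n_i$ for $i\le j$. Its \emph{De Morgan--P\l onka sum} is the algebra on the disjoint union of the $F(i)$ in which, for $a\in F(i)$, $b\in F(j)$ and $k=i\vee j$, $a\wedge b=p_{ik}(a)\wedge p_{jk}(b)$, $a\vee b=p_{ik}(a)\vee p_{jk}(b)$ (computed in $F(k)$), and $\lnot a=n_i(a)$. \textbf{Theorem.} The identities valid in $R(Bip(\mathcal{DML}))$ are exactly the regular bipolarly balanced identities valid in $\mathcal{DML}$, and the following four classes of algebras of type $\langle2,2,1\rangle$ coincide: \begin{enumerate} \item $\mathcal{RBDMBL}$; \item $R(Bip(\mathcal{DML}))$;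 \item $V(\mathbf{DM}_4,\mathbf{IS}_2,\mathbf{IS}_3)$; \item the class of algebras isomorphic to De Morgan--P\l onka sums of distributive lattices over involutive semilattices belonging to $V(\mathbf{IS}_2,\mathbf{IS}_3)$ (in type $\langle 2,1\rangle$). \end{enumerate} -/

import Mathlib

universe u v

namespace DeMorganPlonka

open FirstOrder FirstOrder.Language CategoryTheory

/-! ### Universal algebra: classes of algebras, identities, generated varieties

An algebra of a given type is a structure for a `FirstOrder.Language` without relation symbols; a
class of algebras is a `Set (Bundled L.Structure)`. Algebras have nonempty universes. -/

section UniversalAlgebra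

variable {L : FirstOrder.Language.{0, 0}}

/-- The direct product of a family of algebras. -/
instance piStructure {J : Type u} (B : J → Bundled.{v} L.Structure) :
    L.Structure (∀ j, B j) where
  funMap f x := fun j => Structure.funMap f (fun k => x k j)
  RelMap r x := ∀ j, Structure.RelMap r (fun k => x k j)

/-- `V(K) = HSP(K)`: the variety generated by `K` consists of the homomorphic images of
subalgebras of direct products of (families, indexed by arbitrary sets, of) members of `K`. -/
def generatedVariety (K : Set (Bundled.{v} L.Structure)) : Set (Bundled.{u} L.Structure) :=
  {A | Nonempty A ∧
    ∃ (J : Type u) (B : J → Bundled.{v} L.Structure) (S : L.Substructure (∀ j, B j))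
      (h : S →[L] A), (∀ j, B j ∈ K) ∧ Function.Surjective h}

/-- The algebra `A` satisfies the identity `φ ≈ ψ`. -/
def Satisfies (A : Bundled.{u} L.Structure) (φ ψ : L.Term ℕ) : Prop :=
  ∀ x : ℕ → A, φ.realize x = ψ.realize x

/-- The identity `φ ≈ ψ` is valid in the class `K`. -/
def Valid (K : Set (Bundled.{u} L.Structure)) (φ ψ : L.Term ℕ) : Prop :=
  ∀ A ∈ K, Satisfies A φ ψ

end UniversalAlgebra

/-! ### The type `⟨2, 2, 1⟩` -/

/-- The operation symbols `∧`, `∨`, `¬`. -/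
inductive DMOp : ℕ → Type
  | meet : DMOp 2
  | join : DMOp 2
  | neg : DMOp 1

/-- The type `⟨2, 2, 1⟩` of De Morgan bisemilattices. -/
def dmLang : FirstOrder.Language.{0, 0} := ⟨DMOp, fun _ => Empty⟩

/-- The algebra of type `⟨2, 2, 1⟩` with the given operations. -/
@[reducible] def mkDM {A : Type u} (meet join : A → A → A) (neg : A → A) : dmLang.Structure A where
  funMap := fun {n} f => match n, f with
    | _, DMOp.meet => fun x => meet (x 0) (x 1)
    | _, DMOp.join => fun x => join (x 0) (x 1)
    | _, DMOp.neg => fun x => neg (x 0)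
  RelMap := fun {_} r => Empty.elim r

section Operations

variable {A : Type u} [dmLang.Structure A]

def meet (a b : A) : A := Structure.funMap (L := dmLang) DMOp.meet ![a, b]

def join (a b : A) : A := Structure.funMap (L := dmLang) DMOp.join ![a, b]

def neg (a : A) : A := Structure.funMap (L := dmLang) DMOp.neg ![a]

end Operations

local infixl:69 "⊓ₐ" => meet
local infixl:68 "⊔ₐ" => join
local prefix:max "¬ₐ" => neg

/-- `⟨A, ∧, ∨⟩` is a distributive bisemilattice and `¬` is a De Morgan involution. -/
structure IsDeMorganBisemilattice (A : Type u) [dmLang.Structure A] : Prop where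
  meet_idem : ∀ x : A, x ⊓ₐ x = x
  meet_comm : ∀ x y : A, x ⊓ₐ y = y ⊓ₐ x
  meet_assoc : ∀ x y z : A, (x ⊓ₐ y) ⊓ₐ z = x ⊓ₐ (y ⊓ₐ z)
  join_idem : ∀ x : A, x ⊔ₐ x = x
  join_comm : ∀ x y : A, x ⊔ₐ y = y ⊔ₐ x
  join_assoc : ∀ x y z : A, (x ⊔ₐ y) ⊔ₐ z = x ⊔ₐ (y ⊔ₐ z)
  meet_join : ∀ x y z : A, x ⊓ₐ (y ⊔ₐ z) = (x ⊓ₐ y) ⊔ₐ (x ⊓ₐ z)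
  join_meet : ∀ x y z : A, x ⊔ₐ (y ⊓ₐ z) = (x ⊔ₐ y) ⊓ₐ (x ⊔ₐ z)
  neg_neg : ∀ x : A, ¬ₐ (¬ₐ x) = x
  neg_meet : ∀ x y : A, ¬ₐ (x ⊓ₐ y) = (¬ₐ x) ⊔ₐ (¬ₐ y)
  neg_join : ∀ x y : A, ¬ₐ (x ⊔ₐ y) = (¬ₐ x) ⊓ₐ (¬ₐ y)

/-- `⟨A, ∧, ∨⟩` is a distributive lattice and `¬` is a De Morgan involution. -/
structure IsDeMorganLattice (A : Type u) [dmLang.Structure A] : Prop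
    extends IsDeMorganBisemilattice A where
  meet_join_self : ∀ x y : A, x ⊓ₐ (x ⊔ₐ y) = x
  join_meet_self : ∀ x y : A, x ⊔ₐ (x ⊓ₐ y) = x

/-- The variety of De Morgan lattices. -/
def DML : Set (Bundled.{u} dmLang.Structure) :=
  {A | Nonempty A ∧ IsDeMorganLattice A}

/-- The variety of regular bipolarly absorptive De Morgan bisemilattices. -/
def RBDMBL : Set (Bundled.{u} dmLang.Structure) :=
  {A | Nonempty A ∧ IsDeMorganBisemilattice A ∧ ∀ x y : A,
    x ⊓ₐ (x ⊔ₐ ¬ₐ x) ⊓ₐ (x ⊔ₐ ¬ₐ x ⊔ₐ y) = x ⊓ₐ (x ⊔ₐ ¬ₐ x) ⊓ₐ (x ⊔ₐ ¬ₐ x ⊔ₐ ¬ₐ y)}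

/-! ### Polarities of variables and the regular bipolarly balanced regularisation -/

/-- Whether an operation symbol is the negation. -/
def DMOp.isNeg : {n : ℕ} → DMOp n → Bool
  | _, .meet => false
  | _, .join => false
  | _, .neg => true

/-- `polVars true φ` is `Var⁺(φ)` and `polVars false φ` is `Var⁻(φ)`: the variables with an
occurrence in `φ` in the scope of an even, respectively odd, number of negations. -/
def polVars : Bool → dmLang.Term ℕ → Set ℕ
  | s, .var n => {k | k = n ∧ s = true}
  | s, .func f ts => ⋃ i, polVars (xor s (DMOp.isNeg f)) (ts i)

def IsRegular (φ ψ : dmLang.Term ℕ) : Prop := φ.varFinset = ψ.varFinset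

def IsBalancedRegular (φ ψ : dmLang.Term ℕ) : Prop :=
  polVars true φ = polVars true ψ ∧ polVars false φ = polVars false ψ

def IsBipolar (φ ψ : dmLang.Term ℕ) : Prop :=
  (polVars true φ ∩ polVars false φ).Nonempty ∧ (polVars true ψ ∩ polVars false ψ).Nonempty

def IsRegularBipolarlyBalanced (φ ψ : dmLang.Term ℕ) : Prop :=
  (IsBipolar φ ψ ∧ IsRegular φ ψ) ∨ IsBalancedRegular φ ψ

/-- `R(Bip(V))`: the class of all algebras satisfying the regular bipolarly balanced identities
that are valid in `V`. -/
def RBip (V : Set (Bundled.{u} dmLang.Structure)) : Set (Bundled.{u} dmLang.Structure) :=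
  {A | Nonempty A ∧
    ∀ φ ψ : dmLang.Term ℕ, IsRegularBipolarlyBalanced φ ψ → Valid V φ ψ → Satisfies A φ ψ}

/-! ### Involutive semilattices -/

/-- Involutive (join) semilattices. -/
class InvolutiveSemilattice (I : Type u) extends SemilatticeSup I where
  inv : I → I
  inv_inv : ∀ i, inv (inv i) = i
  inv_sup : ∀ i j, inv (i ⊔ j) = inv i ⊔ inv j

open InvolutiveSemilattice (inv)

theorem inv_mono {I : Type u} [InvolutiveSemilattice I] {i j : I} (h : i ≤ j) :
    inv i ≤ inv j := by
  rw [← sup_eq_right] at h ⊢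
  rw [← InvolutiveSemilattice.inv_sup, h]

/-- The operation symbols of type `⟨2, 1⟩`. -/
inductive ISOp : ℕ → Type
  | sup : ISOp 2
  | inv : ISOp 1

/-- The type `⟨2, 1⟩` of involutive semilattices. -/
def isLang : FirstOrder.Language.{0, 0} := ⟨ISOp, fun _ => Empty⟩

/-- An involutive semilattice as an algebra of type `⟨2, 1⟩`. -/
instance isStructure (I : Type u) [InvolutiveSemilattice I] : isLang.Structure I where
  funMap := fun {n} f => match n, f with
    | _, ISOp.sup => fun x => x 0 ⊔ x 1
    | _, ISOp.inv => fun x => inv (x 0)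
  RelMap := fun {_} r => Empty.elim r

abbrev asIS (I : Type u) [InvolutiveSemilattice I] : Bundled.{u} isLang.Structure :=
  ⟨I, isStructure I⟩

/-- An involutive semilattice as an algebra of type `⟨2, 2, 1⟩` satisfying `x ∧ y ≈ x ∨ y`. -/
instance dmStructure (I : Type u) [InvolutiveSemilattice I] : dmLang.Structure I :=
  mkDM (· ⊔ ·) (· ⊔ ·) inv

abbrev asDM (I : Type u) [InvolutiveSemilattice I] : Bundled.{u} dmLang.Structure :=
  ⟨I, dmStructure I⟩

/-! ### The algebras `IS₂`, `IS₃` and `DM₄` -/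

/-- The universe of `IS₂`: the chain `i < j` with both elements fixed by the involution. -/
inductive IS2
  | i | j

namespace IS2

def sup : IS2 → IS2 → IS2
  | i, i => i
  | _, _ => j

instance : Max IS2 := ⟨sup⟩

instance : InvolutiveSemilattice IS2 where
  toSemilatticeSup := SemilatticeSup.mk'
    (by rintro ⟨⟩ ⟨⟩ <;> rfl) (by rintro ⟨⟩ ⟨⟩ ⟨⟩ <;> rfl) (by rintro ⟨⟩ <;> rfl)
  inv := id
  inv_inv _ := rfl
  inv_sup _ _ := rfl

end IS2

/-- The universe of `IS₃`: incomparable elements `i` and `ni = ¬ i` with join `j = ¬ j`. -/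
inductive IS3
  | i | ni | j

namespace IS3

def sup : IS3 → IS3 → IS3
  | i, i => i
  | ni, ni => ni
  | _, _ => j

def neg : IS3 → IS3
  | i => ni
  | ni => i
  | j => j

instance : Max IS3 := ⟨sup⟩

instance : InvolutiveSemilattice IS3 where
  toSemilatticeSup := SemilatticeSup.mk'
    (by rintro ⟨⟩ ⟨⟩ <;> rfl) (by rintro ⟨⟩ ⟨⟩ ⟨⟩ <;> rfl) (by rintro ⟨⟩ <;> rfl)
  inv := neg
  inv_inv := by rintro ⟨⟩ <;> rfl
  inv_sup := by rintro ⟨⟩ ⟨⟩ <;> rfl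

end IS3

/-- The universe of `DM₄`: bottom `f = ¬ t`, top `t = ¬ f`, and two incomparable elements
`a = ¬ a` and `b = ¬ b`. -/
inductive DM4
  | t | f | a | b

namespace DM4

def inf : DM4 → DM4 → DM4
  | t, x => x
  | x, t => x
  | a, a => a
  | b, b => b
  | _, _ => f

def sup : DM4 → DM4 → DM4
  | f, x => x
  | x, f => x
  | a, a => a
  | b, b => b
  | _, _ => t

def neg : DM4 → DM4
  | t => f
  | f => t
  | a => a
  | b => b

/-- The De Morgan lattice `DM₄`. -/
instance dmStructure : dmLang.Structure DM4 := mkDM inf sup neg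

abbrev alg : Bundled.{0} dmLang.Structure := ⟨DM4, dmStructure⟩

end DM4

/-! ### De Morgan–Płonka sums of distributive lattices -/

/-- An involutive semilattice direct system of (nonempty) distributive lattices over `I`; the
dualised type is `⟨∧, ∨⟩`, with the two symbols dual to each other. -/
structure DirectSystem (I : Type u) [InvolutiveSemilattice I] where
  /-- the fibres -/
  Fib : I → Type u
  lattice : ∀ i, DistribLattice (Fib i)
  nonempty : ∀ i, Nonempty (Fib i)
  /-- the transition maps -/
  p : ∀ {i j : I}, i ≤ j → LatticeHom (Fib i) (Fib j)
  p_id : ∀ (i : I) (x : Fib i), p (le_refl i) x = x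
  p_comp : ∀ {i j k : I} (hij : i ≤ j) (hjk : j ≤ k) (x : Fib i),
    p hjk (p hij x) = p (hij.trans hjk) x
  /-- the dualising maps: isomorphisms from the fibre at `i` to the dual of the fibre at `inv i`,
  the one at `inv i` being inverse to the one at `i` -/
  n : ∀ i : I, Fib i → Fib (inv i)
  n_inf : ∀ (i : I) (x y : Fib i), n i (x ⊓ y) = n i x ⊔ n i y
  n_sup : ∀ (i : I) (x y : Fib i), n i (x ⊔ y) = n i x ⊓ n i y
  n_n : ∀ (i : I) (x : Fib i), (⟨inv (inv i), n (inv i) (n i x)⟩ : Σ k, Fib k) = ⟨i, x⟩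
  n_p : ∀ {i j : I} (h : i ≤ j) (x : Fib i), n j (p h x) = p (inv_mono h) (n i x)

attribute [instance] DirectSystem.lattice DirectSystem.nonempty

namespace DirectSystem

variable {I : Type u} [InvolutiveSemilattice I] (F : DirectSystem I)

/-- The operations of the De Morgan–Płonka sum, on the disjoint union of the fibres. -/
instance sumStructure : dmLang.Structure (Σ i, F.Fib i) := mkDM
  (fun x y => ⟨x.1 ⊔ y.1,
    F.p (le_sup_left : x.1 ≤ x.1 ⊔ y.1) x.2 ⊓ F.p (le_sup_right : y.1 ≤ x.1 ⊔ y.1) y.2⟩)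
  (fun x y => ⟨x.1 ⊔ y.1,
    F.p (le_sup_left : x.1 ≤ x.1 ⊔ y.1) x.2 ⊔ F.p (le_sup_right : y.1 ≤ x.1 ⊔ y.1) y.2⟩)
  (fun x => ⟨inv x.1, F.n x.1 x.2⟩)

/-- The De Morgan–Płonka sum over a direct system. -/
abbrev sum : Bundled.{u} dmLang.Structure := ⟨Σ i, F.Fib i, F.sumStructure⟩

end DirectSystem

/-- The class of (isomorphic copies of) De Morgan–Płonka sums of distributive lattices over
involutive semilattices belonging to `W`. -/
def PlonkaSumsOver (W : Set (Bundled.{u} isLang.Structure)) :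
    Set (Bundled.{u} dmLang.Structure) :=
  {A | ∃ (I : Type u) (_ : InvolutiveSemilattice I) (F : DirectSystem I),
    asIS I ∈ W ∧ Nonempty (A ≃[dmLang] F.sum)}

end DeMorganPlonka

open DeMorganPlonka (dmLang DML RBDMBL RBip Valid IsRegularBipolarlyBalanced generatedVariety
  PlonkaSumsOver asDM asIS IS2 IS3 DM4)

/-!
# Regular bipolarly absorptive De Morgan bisemilattices

The four classes are compared along the inclusions

  `RBDMBL ⊆ PlonkaSumsOver (V(IS₂, IS₃)) ⊆ R(Bip(DML)) ⊆ V(DM₄, IS₂, IS₃) ⊆ RBDMBL`.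

*Decomposition.* In a De Morgan bisemilattice, `x ∧ (x ∨ b)` is a partition function in the sense
of Płonka, and it commutes with `¬`. Preordering the elements by "`b` is not moved towards `a`"
and passing to the quotient gives an involutive semilattice of indices; the fibres are distributive
lattices, with the maps `x ↦ x ∧ (x ∨ b)` between them, and the algebra is the De Morgan–Płonka sum
of this system (`IsDeMorganBisemilattice.equivSum`). The identity defining `RBDMBL` becomes
`x ∨ ¬x ∨ y ≈ x ∨ ¬x ∨ ¬y` in the semilattice of indices. This says that every element above both
`c` and `¬c` is fixed (`FixesBipolar`), and it characterises `V(IS₂, IS₃)`, because the principal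
ideals of such a semilattice are the preimages of `i` under homomorphisms to `IS₂` and `IS₃`
(`mem_generatedVariety_of_fixesBipolar`, `fixesBipolar_of_mem_generatedVariety`).

*Identities of sums.* A term in a De Morgan–Płonka sum takes a value with index `k`, which only
depends on the indices of the arguments. The value is computed in the fibre `D` over `k`, which
need not be closed under `¬`; it is the first coordinate of the value of the term in the De Morgan
lattice `D × Dᵒᵈ` with the exchange of coordinates as involution
(`DirectSystem.p_realize`). So an identity holds in the sum if it holds in `DML` and in the
semilattice of indices (`DirectSystem.satisfies_sum`).

*Identities of the generators.* The value of a term in an involutive semilattice is the join of its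
literals (`realize_le_iff`), so the regular bipolarly balanced identities are exactly the ones
valid in `IS₂` and `IS₃`. Prime filters show that the identities of `DM₄` are those of `DML`
(`valid_DML_of_satisfies_DM4`). With Birkhoff's theorem (`mem_generatedVariety_of_satisfies`) this
gives `R(Bip(DML)) ⊆ V(DM₄, IS₂, IS₃)`, as well as the description of the identities valid in
`R(Bip(DML))`.
-/

namespace DeMorganPlonka

open FirstOrder FirstOrder.Language CategoryTheory
open InvolutiveSemilattice (inv)

/-! ### Identities and generated varieties -/

section UniversalAlgebra

variable {L : FirstOrder.Language.{0, 0}}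

theorem realize_congr_of_varFinset {α : Type*} [DecidableEq α] {M : Type*} [L.Structure M]
    {v w : α → M} : ∀ t : L.Term α, (∀ a ∈ t.varFinset, v a = w a) → t.realize v = t.realize w
  | .var a, h => h a (by simp [Term.varFinset])
  | .func f ts, h => by
    simp only [Term.realize_func]
    congr 1
    funext i
    refine realize_congr_of_varFinset (ts i) fun a ha => h a ?_
    simp only [Term.varFinset, Finset.mem_biUnion, Finset.mem_univ, true_and]
    exact ⟨i, ha⟩

theorem realize_pi {α : Type*} {J : Type u} {B : J → Bundled.{v} L.Structure}
    (x : α → ∀ j, B j) (j : J) (t : L.Term α) :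
    t.realize x j = t.realize fun a => x a j := by
  induction t with
  | var a => rfl
  | func f ts ih =>
    simp only [Term.realize_func]
    change Structure.funMap f _ = _
    congr 1
    funext i
    exact ih i

theorem realize_substructure_coe {α : Type*} {M : Type*} [L.Structure M] (S : L.Substructure M)
    (x : α → S) (t : L.Term α) : ((t.realize x : S) : M) = t.realize fun a => (x a : M) :=
  (HomClass.realize_term S.subtype (t := t) (v := x)).symm

/-- Homomorphic images of subalgebras of products inherit identities. -/
theorem satisfies_of_mem_generatedVariety {K : Set (Bundled.{v} L.Structure)} {φ ψ : L.Term ℕ}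
    (h : Valid K φ ψ) {A : Bundled.{u} L.Structure} (hA : A ∈ generatedVariety K) :
    Satisfies A φ ψ := by
  obtain ⟨-, J, B, S, g, hB, hg⟩ := hA
  intro x
  choose y hy using fun n => hg (x n)
  have hx : x = g ∘ y := funext fun n => (hy n).symm
  rw [hx, HomClass.realize_term g, HomClass.realize_term g]
  congr 1
  refine Subtype.ext (funext fun j => ?_)
  rw [realize_substructure_coe, realize_substructure_coe, realize_pi, realize_pi]
  exact h _ (hB j) _

/-- Powers of `B` move algebras from the lowest universe to any other, without changing their
identities. -/
theorem satisfies_const_pi_iff {B : Bundled.{v} L.Structure} {φ ψ : L.Term ℕ} :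
    Satisfies (⟨PUnit.{u + 1} → B, piStructure fun _ => B⟩ : Bundled L.Structure) φ ψ ↔
      Satisfies B φ ψ := by
  constructor
  · intro h x
    have := congrFun (h fun n _ => x n) PUnit.unit
    rwa [realize_pi, realize_pi] at this
  · intro h x
    funext j
    exact (realize_pi x j φ).trans ((h _).trans (realize_pi x j ψ).symm)

theorem const_pi_mem_generatedVariety {K : Set (Bundled.{0} L.Structure)}
    {B : Bundled.{0} L.Structure} (hB : B ∈ K) [Nonempty B] :
    (⟨PUnit.{u + 1} → B, piStructure fun _ => B⟩ : Bundled.{u} L.Structure) ∈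
      generatedVariety.{u} K :=
  ⟨inferInstanceAs (Nonempty (PUnit → B)), PUnit, fun _ => B, ⊤,
    (⊤ : L.Substructure (PUnit.{u + 1} → B)).subtype.toHom, fun _ => hB,
    fun a => ⟨⟨a, trivial⟩, rfl⟩⟩

/-- An algebra that embeds into a product of members of `K` belongs to the variety generated
by `K`: it is a homomorphic image of its own image. -/
theorem mem_generatedVariety_of_separating [L.IsAlgebraic] {K : Set (Bundled.{v} L.Structure)}
    {A : Bundled.{u} L.Structure} [Nonempty A]
    (h : ∀ a b : A, a ≠ b → ∃ B ∈ K, ∃ g : A →[L] B, g a ≠ g b) :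
    A ∈ generatedVariety K := by
  choose B hBK g hg using fun p : {p : A × A // p.1 ≠ p.2} => h p.1.1 p.1.2 p.2
  let G : A →[L] (∀ p, B p) :=
    { toFun := fun a p => g p a
      map_fun' := fun f x => funext fun p => (g p).map_fun f x
      map_rel' := fun r => isEmptyElim r }
  have hG : Function.Injective G := by
    intro a b hab
    by_contra hne
    exact hg ⟨(a, b), hne⟩ (congrFun hab ⟨(a, b), hne⟩)
  choose k hk using fun s : G.range => s.2
  refine ⟨‹_›, _, B, G.range,
    { toFun := k
      map_fun' := fun f x => hG ?_
      map_rel' := fun r => isEmptyElim r }, hBK, fun a => ⟨⟨G a, a, rfl⟩, hG (hk _)⟩⟩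
  rw [hk, G.map_fun]
  change Structure.funMap f _ = _
  congr 1
  funext i
  exact (hk _).symm

/-- **Birkhoff's theorem**: an algebra satisfying the identities valid in `K` is a quotient of
the subalgebra of term functions in a product of members of `K`. -/
theorem mem_generatedVariety_of_satisfies [L.IsAlgebraic] {K : Set (Bundled.{v} L.Structure)}
    {A : Bundled.{u} L.Structure} [Nonempty A]
    (h : ∀ φ ψ : L.Term ℕ, Valid K φ ψ → Satisfies A φ ψ) : A ∈ generatedVariety K := by
  classical
  -- indexing by the pairs of terms separated in `K` keeps the index type in the universe of `A`
  let J := {p : L.Term A × L.Term A // ∃ B ∈ K, ∃ v : A → B, p.1.realize v ≠ p.2.realize v}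
  choose B hBK v hv using fun j : J => j.2
  let ev : L.Term A → ∀ j, B j := fun t j => t.realize (v j)
  have hev : ∀ s t, ev s = ev t → s.realize (id : A → A) = t.realize id := by
    intro s t hst
    have hK : ∀ C ∈ K, ∀ w : A → C, s.realize w = t.realize w := by
      by_contra! hne
      exact hv ⟨(s, t), hne⟩ (congrFun hst ⟨(s, t), hne⟩)
    -- rename the finitely many variables of `s` and `t` by natural numbers
    let V := s.varFinset ∪ t.varFinset
    let e : V → ℕ := fun a => V.equivFin a
    have he : Function.Injective e := fun a b hab => V.equivFin.injective (Fin.ext hab)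
    let f : A → ℕ := fun a => if ha : a ∈ V then e ⟨a, ha⟩ else 0
    let g : ℕ → A := fun n => if hn : ∃ a, e a = n then hn.choose else Classical.arbitrary A
    have hgf : ∀ a ∈ V, g (f a) = a := by
      intro a ha
      have hf : f a = e ⟨a, ha⟩ := dif_pos ha
      have hex : ∃ b, e b = f a := ⟨_, hf.symm⟩
      have : g (f a) = hex.choose := dif_pos hex
      rw [this, he (hex.choose_spec.trans hf)]
    have key := h (s.relabel f) (t.relabel f)
      (fun C hC x => by simpa using hK C hC (x ∘ f)) g
    rw [Term.realize_relabel, Term.realize_relabel] at key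
    rw [realize_congr_of_varFinset s (v := id) (w := g ∘ f)
        fun a ha => (hgf a (Finset.mem_union_left _ ha)).symm, key]
    exact realize_congr_of_varFinset t fun a ha => hgf a (Finset.mem_union_right _ ha)
  have hfun : ∀ {n} (o : L.Functions n) (ts : Fin n → L.Term A),
      ev (Term.func o ts) = Structure.funMap o fun i => ev (ts i) := fun _ _ => rfl
  let S : L.Substructure (∀ j, B j) :=
    { carrier := Set.range ev
      fun_mem := by
        intro n o x hx
        choose ts hts using hx
        exact ⟨Term.func o ts, by rw [hfun]; congr 1; funext i; exact hts i⟩ }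
  choose k hk using fun s : S => s.2
  refine ⟨‹_›, J, B, S,
    { toFun := fun s => (k s).realize id
      map_fun' := fun o x => ?_
      map_rel' := fun r => isEmptyElim r }, hBK, fun a => ⟨⟨ev (Term.var a), _, rfl⟩, ?_⟩⟩
  · refine hev _ (Term.func o fun i => k (x i)) ?_
    rw [hk, hfun]
    change Structure.funMap o _ = _
    congr 1
    funext i
    exact (hk _).symm
  · exact hev _ (Term.var a) (hk _)

end UniversalAlgebra

/-! ### Terms of type `⟨2, 2, 1⟩` -/

instance : dmLang.IsAlgebraic := fun _ => inferInstanceAs (IsEmpty Empty)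

instance : isLang.IsAlgebraic := fun _ => inferInstanceAs (IsEmpty Empty)

section Terms

/-- The term `s ∧ t`. -/
def tmeet {α : Type*} (s t : dmLang.Term α) : dmLang.Term α :=
  Term.func (L := dmLang) (l := 2) DMOp.meet ![s, t]

/-- The term `s ∨ t`. -/
def tjoin {α : Type*} (s t : dmLang.Term α) : dmLang.Term α :=
  Term.func (L := dmLang) (l := 2) DMOp.join ![s, t]

/-- The term `¬t`. -/
def tneg {α : Type*} (t : dmLang.Term α) : dmLang.Term α :=
  Term.func (L := dmLang) (l := 1) DMOp.neg ![t]

/-- Induction on terms, with a separate case for each operation symbol. -/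
theorem term_induction {α : Type*} {P : dmLang.Term α → Prop} (var : ∀ a, P (.var a))
    (meet : ∀ s t, P s → P t → P (tmeet s t)) (join : ∀ s t, P s → P t → P (tjoin s t))
    (neg : ∀ t, P t → P (tneg t)) (t : dmLang.Term α) : P t := by
  induction t with
  | var a => exact var a
  | func f ts ih =>
    cases f with
    | meet =>
      have h : ts = ![ts 0, ts 1] := by funext i; fin_cases i <;> rfl
      rw [h]; exact meet _ _ (ih 0) (ih 1)
    | join =>
      have h : ts = ![ts 0, ts 1] := by funext i; fin_cases i <;> rfl
      rw [h]; exact join _ _ (ih 0) (ih 1)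
    | neg =>
      have h : ts = ![ts 0] := by funext i; fin_cases i; rfl
      rw [h]; exact neg _ (ih 0)

section Realize

variable {α A : Type*} [dmLang.Structure A] (v : α → A) (s t : dmLang.Term α)

@[simp] theorem realize_tmeet : (tmeet s t).realize v = meet (s.realize v) (t.realize v) :=
  congrArg (Structure.funMap (L := dmLang) DMOp.meet)
    (by funext i; fin_cases i <;> rfl)

@[simp] theorem realize_tjoin : (tjoin s t).realize v = join (s.realize v) (t.realize v) :=
  congrArg (Structure.funMap (L := dmLang) DMOp.join)
    (by funext i; fin_cases i <;> rfl)

@[simp] theorem realize_tneg : (tneg t).realize v = neg (t.realize v) :=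
  congrArg (Structure.funMap (L := dmLang) DMOp.neg)
    (by funext i; fin_cases i; rfl)

end Realize

theorem polVars_var (b : Bool) (n : ℕ) : polVars b (.var n) = {k | k = n ∧ b = true} := by
  rw [polVars]

theorem polVars_tmeet (b : Bool) (s t : dmLang.Term ℕ) :
    polVars b (tmeet s t) = polVars b s ∪ polVars b t := by
  ext n
  simp [tmeet, polVars, DMOp.isNeg, Fin.exists_fin_two]

theorem polVars_tjoin (b : Bool) (s t : dmLang.Term ℕ) :
    polVars b (tjoin s t) = polVars b s ∪ polVars b t := by
  ext n
  simp [tjoin, polVars, DMOp.isNeg, Fin.exists_fin_two]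

theorem polVars_tneg (b : Bool) (t : dmLang.Term ℕ) : polVars b (tneg t) = polVars (!b) t := by
  ext n
  simp [tneg, polVars, DMOp.isNeg]

theorem mem_varFinset_iff (t : dmLang.Term ℕ) (n : ℕ) :
    n ∈ t.varFinset ↔ n ∈ polVars true t ∨ n ∈ polVars false t := by
  induction t using term_induction with
  | var a => simp [Term.varFinset, polVars_var]
  | meet s t hs ht =>
    have : (tmeet s t).varFinset = s.varFinset ∪ t.varFinset := by
      ext; simp [tmeet, Term.varFinset, Fin.exists_fin_two]
    rw [this, Finset.mem_union, hs, ht, polVars_tmeet, polVars_tmeet, Set.mem_union,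
      Set.mem_union]
    tauto
  | join s t hs ht =>
    have : (tjoin s t).varFinset = s.varFinset ∪ t.varFinset := by
      ext; simp [tjoin, Term.varFinset, Fin.exists_fin_two]
    rw [this, Finset.mem_union, hs, ht, polVars_tjoin, polVars_tjoin, Set.mem_union,
      Set.mem_union]
    tauto
  | neg t ht =>
    have : (tneg t).varFinset = t.varFinset := by
      ext; simp [tneg, Term.varFinset]
    rw [this, ht, polVars_tneg, polVars_tneg, or_comm]
    rfl

end Terms

/-! ### Involutive semilattices and balanced identities -/

section InvolutiveSemilattices

variable {I : Type u} [InvolutiveSemilattice I]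

theorem inv_le_iff {a b : I} : inv a ≤ b ↔ a ≤ inv b :=
  ⟨fun h => by simpa only [InvolutiveSemilattice.inv_inv] using inv_mono h,
    fun h => by simpa only [InvolutiveSemilattice.inv_inv] using inv_mono h⟩

/-- The order form of the identity `x ∨ ¬x ∨ y ≈ x ∨ ¬x ∨ ¬y`, which axiomatises the variety
generated by `IS₂` and `IS₃`: every element above both `c` and `¬c` is fixed by the
involution. -/
def FixesBipolar (I : Type u) [InvolutiveSemilattice I] : Prop :=
  ∀ c b : I, c ≤ b → inv c ≤ b → inv b = b

theorem FixesBipolar.of_sup (h : ∀ c b : I, c ⊔ inv c ⊔ b = c ⊔ inv c ⊔ inv b) :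
    FixesBipolar I := by
  intro c b h1 h2
  have h3 := h c b
  rwa [sup_eq_right.2 (sup_le h1 h2), sup_eq_right.2 (sup_le (inv_le_iff.1 h2) (inv_mono h1)),
    eq_comm] at h3

theorem FixesBipolar.sup_inv (h : FixesBipolar I) (c b : I) :
    c ⊔ (inv c ⊔ b) = c ⊔ (inv c ⊔ inv b) := by
  have h1 := h c (c ⊔ (inv c ⊔ b)) le_sup_left (le_sup_left.trans le_sup_right)
  rw [InvolutiveSemilattice.inv_sup, InvolutiveSemilattice.inv_sup,
    InvolutiveSemilattice.inv_inv] at h1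
  rw [← h1]
  exact sup_left_comm _ _ _

section Operations

variable (a b : I)

theorem dm_meet_eq : meet a b = a ⊔ b := rfl

theorem dm_join_eq : join a b = a ⊔ b := rfl

theorem dm_neg_eq : neg a = inv a := rfl

end Operations

/-- The value of a term in an involutive semilattice is the join of its literals. -/
theorem realize_le_iff (x : ℕ → I) (φ : dmLang.Term ℕ) (b : I) :
    φ.realize x ≤ b ↔
      (∀ n ∈ polVars true φ, x n ≤ b) ∧ ∀ n ∈ polVars false φ, inv (x n) ≤ b := by
  induction φ using term_induction generalizing b with
  | var a => simp [polVars_var]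
  | meet s t hs ht =>
    rw [realize_tmeet, dm_meet_eq, sup_le_iff, hs, ht, polVars_tmeet, polVars_tmeet]
    simp only [Set.mem_union, or_imp, forall_and]
    tauto
  | join s t hs ht =>
    rw [realize_tjoin, dm_join_eq, sup_le_iff, hs, ht, polVars_tjoin, polVars_tjoin]
    simp only [Set.mem_union, or_imp, forall_and]
    tauto
  | neg t ht =>
    rw [realize_tneg, dm_neg_eq, inv_le_iff, ht, polVars_tneg, polVars_tneg]
    simp only [← inv_le_iff, InvolutiveSemilattice.inv_inv]
    exact and_comm

/-- The identity defining `FixesBipolar` entails all regular bipolarly balanced ones. -/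
theorem FixesBipolar.satisfies (h : FixesBipolar I) {φ ψ : dmLang.Term ℕ}
    (hφψ : IsRegularBipolarlyBalanced φ ψ) : Satisfies (asDM I) φ ψ := by
  intro x
  change φ.realize x = ψ.realize x
  refine eq_of_forall_ge_iff fun b => ?_
  rw [realize_le_iff, realize_le_iff]
  rcases hφψ with ⟨⟨hφ, hψ⟩, hr⟩ | ⟨h1, h2⟩
  · -- an upper bound of a bipolar term is fixed, so it lies above either both or none of
    -- the literals in a variable
    have key : ∀ χ : dmLang.Term ℕ, (polVars true χ ∩ polVars false χ).Nonempty →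
        (((∀ n ∈ polVars true χ, x n ≤ b) ∧ ∀ n ∈ polVars false χ, inv (x n) ≤ b) ↔
          inv b = b ∧ ∀ n ∈ χ.varFinset, x n ≤ b) := by
      rintro χ ⟨m, hm1, hm2⟩
      constructor
      · rintro ⟨h1, h2⟩
        have hb := h _ _ (h1 m hm1) (h2 m hm2)
        refine ⟨hb, fun n hn => ?_⟩
        rcases (mem_varFinset_iff χ n).1 hn with hn | hn
        · exact h1 n hn
        · exact hb ▸ inv_le_iff.1 (h2 n hn)
      · rintro ⟨hb, h1⟩
        exact ⟨fun n hn => h1 n ((mem_varFinset_iff χ n).2 (.inl hn)),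
          fun n hn => inv_le_iff.2 (hb.symm ▸ h1 n ((mem_varFinset_iff χ n).2 (.inr hn)))⟩
    rw [key φ hφ, key ψ hψ, show φ.varFinset = ψ.varFinset from hr]
  · rw [h1, h2]

theorem IS2.le_i_iff (a : IS2) : a ≤ IS2.i ↔ a = IS2.i := by
  cases a
  · simp
  · exact ⟨fun h => (show IS2.j = IS2.i from h), fun h => by cases h⟩

theorem IS3.le_i_iff (a : IS3) : a ≤ IS3.i ↔ a = IS3.i := by
  cases a
  · simp
  · exact ⟨fun h => (by cases (show IS3.j = IS3.i from h)), fun h => by cases h⟩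
  · exact ⟨fun h => (show IS3.j = IS3.i from h), fun h => by cases h⟩

theorem fixesBipolar_IS2 : FixesBipolar IS2 := fun _ _ _ _ => rfl

theorem fixesBipolar_IS3 : FixesBipolar IS3 :=
  .of_sup (by rintro ⟨⟩ ⟨⟩ <;> rfl)

/-- The identities valid in `IS₂` are regular. -/
theorem isRegular_of_satisfies {φ ψ : dmLang.Term ℕ} (h : Satisfies (asDM IS2) φ ψ) :
    IsRegular φ ψ := by
  classical
  have key : ∀ (χ : dmLang.Term ℕ) (n : ℕ),
      n ∈ χ.varFinset ↔ ¬ χ.realize (fun k => if k = n then IS2.j else IS2.i) ≤ IS2.i := by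
    intro χ n
    rw [realize_le_iff, mem_varFinset_iff, not_and_or]
    have hinv : ∀ a : IS2, inv a = a := fun _ => rfl
    simp only [hinv, IS2.le_i_iff]
    simp
  ext n
  rw [key, key, show φ.realize _ = ψ.realize _ from h _]

/-- An identity valid in `IS₃` with a non-bipolar side is balanced: sending the variables of the
literals of that side to `i` or `¬i` makes its value `i`. -/
theorem polVars_subset_of_satisfies {φ ψ : dmLang.Term ℕ} (h : Satisfies (asDM IS3) φ ψ)
    (hφ : ¬ (polVars true φ ∩ polVars false φ).Nonempty) :
    polVars true ψ ⊆ polVars true φ ∧ polVars false ψ ⊆ polVars false φ := by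
  classical
  let x : ℕ → IS3 := fun n =>
    if n ∈ polVars true φ then IS3.i else if n ∈ polVars false φ then IS3.ni else IS3.j
  have h1 : φ.realize x ≤ IS3.i := by
    refine (realize_le_iff _ _ _).2 ⟨fun n hn => by simp [x, hn], fun n hn => ?_⟩
    have hn' : n ∉ polVars true φ := fun hn' => hφ ⟨n, hn', hn⟩
    simp only [x, hn', hn, if_true, if_false]
    exact le_refl IS3.i
  rw [show φ.realize x = ψ.realize x from h x, realize_le_iff] at h1
  constructor
  · intro n hn
    by_contra hn'
    have h2 := (IS3.le_i_iff _).1 (h1.1 n hn)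
    simp only [x, hn', if_false] at h2
    split at h2 <;> cases h2
  · intro n hn
    by_contra hn'
    have h2 := (IS3.le_i_iff _).1 (h1.2 n hn)
    simp only [x, hn', if_false] at h2
    split at h2 <;> cases h2

theorem isRegularBipolarlyBalanced_of_satisfies {φ ψ : dmLang.Term ℕ}
    (h2 : Satisfies (asDM IS2) φ ψ) (h3 : Satisfies (asDM IS3) φ ψ) :
    IsRegularBipolarlyBalanced φ ψ := by
  have h3' : Satisfies (asDM IS3) ψ φ := fun x => (h3 x).symm
  have hbal : ∀ χ ω : dmLang.Term ℕ, polVars true ω ⊆ polVars true χ ∧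
      polVars false ω ⊆ polVars false χ → ¬ (polVars true χ ∩ polVars false χ).Nonempty →
      ¬ (polVars true ω ∩ polVars false ω).Nonempty :=
    fun χ ω h hn hω => hn (hω.mono (Set.inter_subset_inter h.1 h.2))
  by_cases hφ : (polVars true φ ∩ polVars false φ).Nonempty
  · by_cases hψ : (polVars true ψ ∩ polVars false ψ).Nonempty
    · exact .inl ⟨⟨hφ, hψ⟩, isRegular_of_satisfies h2⟩
    · exact absurd hφ (hbal ψ φ (polVars_subset_of_satisfies h3' hψ) hψ)
  · have h := polVars_subset_of_satisfies h3 hφ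
    have h' := polVars_subset_of_satisfies h3' (hbal φ ψ h hφ)
    exact .inr ⟨h'.1.antisymm h.1, h'.2.antisymm h.2⟩

/-! ### The variety generated by `IS₂` and `IS₃` -/

/-- A homomorphism of involutive semilattices as a homomorphism of algebras of type `⟨2, 1⟩`. -/
def isHom {J : Type v} [InvolutiveSemilattice J] (g : I → J)
    (hsup : ∀ a b, g (a ⊔ b) = g a ⊔ g b) (hinv : ∀ a, g (inv a) = inv (g a)) :
    asIS I →[isLang] asIS J where
  toFun := g
  map_fun' f x := by
    cases f with
    | sup => exact hsup _ _
    | inv => exact hinv _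
  map_rel' r := isEmptyElim r

theorem fixesBipolar_of_mem_generatedVariety
    (h : asIS I ∈ generatedVariety {asIS IS2, asIS IS3}) : FixesBipolar I := by
  let c : isLang.Term ℕ := Term.var 0
  let b : isLang.Term ℕ := Term.var 1
  let sup (s t : isLang.Term ℕ) : isLang.Term ℕ := Term.func (L := isLang) (l := 2) ISOp.sup ![s, t]
  let inv' (t : isLang.Term ℕ) : isLang.Term ℕ := Term.func (L := isLang) (l := 1) ISOp.inv ![t]
  have key := satisfies_of_mem_generatedVariety
    (φ := sup (sup c (inv' c)) b) (ψ := sup (sup c (inv' c)) (inv' b)) (by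
      rintro A (rfl | rfl) x
      · have h2 : ∀ c b : IS2, c ⊔ inv c ⊔ b = c ⊔ inv c ⊔ inv b := by rintro ⟨⟩ ⟨⟩ <;> rfl
        exact h2 (x 0) (x 1)
      · have h3 : ∀ c b : IS3, c ⊔ inv c ⊔ b = c ⊔ inv c ⊔ inv b := by rintro ⟨⟩ ⟨⟩ <;> rfl
        exact h3 (x 0) (x 1)) h
  exact .of_sup fun c b => key (fun n => if n = 0 then c else b)

/-- For a fixed element `b`, the elements below `b` form the preimage of `i` under a homomorphism
to `IS₂`; for any other `b` they do so under a homomorphism to `IS₃`. -/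
theorem mem_generatedVariety_of_fixesBipolar [Nonempty I] (h : FixesBipolar I) :
    asIS I ∈ generatedVariety {asIS IS2, asIS IS3} := by
  classical
  refine mem_generatedVariety_of_separating fun a b hab => ?_
  wlog hle : ¬ a ≤ b generalizing a b
  · obtain ⟨B, hB, g, hg⟩ := this b a hab.symm fun hba => hab (le_antisymm (not_not.1 hle) hba)
    exact ⟨B, hB, g, hg.symm⟩
  change I at a b
  by_cases hb : inv b = b
  · refine ⟨asIS IS2, .inl rfl, isHom (fun x => if x ≤ b then IS2.i else IS2.j) ?_ ?_, ?_⟩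
    · intro x y
      by_cases hx : x ≤ b <;> by_cases hy : y ≤ b <;> simp [hx, hy] <;> rfl
    · intro x
      have : inv x ≤ b ↔ x ≤ b := by rw [inv_le_iff, hb]
      simp only [this]
      rfl
    · intro heq
      have heq' : (if a ≤ b then IS2.i else IS2.j) = if b ≤ b then IS2.i else IS2.j := heq
      rw [if_neg hle, if_pos le_rfl] at heq'
      cases heq'
  · -- an element below both `b` and `¬b` would force `b` to be fixed
    have hdisj : ∀ x, x ≤ b → ¬ x ≤ inv b := fun x h1 h2 => hb (h x b h1 (inv_le_iff.2 h2))
    refine ⟨asIS IS3, .inr rfl,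
      isHom (fun x => if x ≤ b then IS3.i else if x ≤ inv b then IS3.ni else IS3.j) ?_ ?_, ?_⟩
    · intro x y
      by_cases hx : x ≤ b <;> by_cases hy : y ≤ b <;> by_cases hx' : x ≤ inv b <;>
        by_cases hy' : y ≤ inv b <;>
        first | exact absurd hx' (hdisj x hx) | exact absurd hy' (hdisj y hy) | skip
      all_goals simp [hx, hy, hx', hy'] <;> rfl
    · intro x
      have h1 : inv x ≤ b ↔ x ≤ inv b := inv_le_iff
      have h2 : inv x ≤ inv b ↔ x ≤ b := by rw [inv_le_iff, InvolutiveSemilattice.inv_inv]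
      simp only [h1, h2]
      by_cases hx : x ≤ b
      · simp only [hx, hdisj x hx, if_true, if_false]; rfl
      · by_cases hx' : x ≤ inv b <;> simp only [hx, hx', if_true, if_false] <;> rfl
    · intro heq
      have heq' : (if a ≤ b then IS3.i else if a ≤ inv b then IS3.ni else IS3.j) =
        if b ≤ b then IS3.i else if b ≤ inv b then IS3.ni else IS3.j := heq
      rw [if_neg hle, if_pos le_rfl] at heq'
      split at heq' <;> cases heq'

end InvolutiveSemilattices

/-! ### De Morgan lattices and `DM₄` -/

section DeMorganLattices

/-- The lattice reduct of a De Morgan lattice. -/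
@[reducible] def IsDeMorganLattice.distribLattice {A : Type u} [dmLang.Structure A]
    (h : IsDeMorganLattice A) : DistribLattice A :=
  letI : Max A := ⟨join⟩
  letI : Min A := ⟨meet⟩
  letI : Lattice A := Lattice.mk' h.join_comm h.join_assoc h.meet_comm h.meet_assoc
    h.join_meet_self h.meet_join_self
  DistribLattice.ofInfSupLe fun a b c => le_of_eq (h.meet_join a b c)

namespace DM4

open Classical in
/-- The element `x` of `DM₄` for which `p` says that `x` lies in the prime filter `{t, a}`, and `q`
that `¬x` does. -/
noncomputable def ofProps (p q : Prop) : DM4 :=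
  if p then if q then a else t else if q then f else b

theorem ofProps_inf (p q p' q' : Prop) :
    ofProps (p ∧ p') (q ∨ q') = meet (ofProps p q) (ofProps p' q') := by
  by_cases p <;> by_cases q <;> by_cases p' <;> by_cases q' <;> simp [ofProps, *] <;> rfl

theorem ofProps_sup (p q p' q' : Prop) :
    ofProps (p ∨ p') (q ∧ q') = join (ofProps p q) (ofProps p' q') := by
  by_cases p <;> by_cases q <;> by_cases p' <;> by_cases q' <;> simp [ofProps, *] <;> rfl

theorem ofProps_neg (p q : Prop) : ofProps q p = DeMorganPlonka.neg (ofProps p q) := by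
  by_cases p <;> by_cases q <;> simp [ofProps, *] <;> rfl

theorem ofProps_inj {p q p' q' : Prop} (h : ofProps p q = ofProps p' q') : p ↔ p' := by
  by_cases p <;> by_cases q <;> by_cases p' <;> by_cases q' <;> simp_all [ofProps]

theorem isDeMorganLattice : IsDeMorganLattice DM4 where
  meet_idem := by rintro ⟨⟩ <;> rfl
  meet_comm := by rintro ⟨⟩ ⟨⟩ <;> rfl
  meet_assoc := by rintro ⟨⟩ ⟨⟩ ⟨⟩ <;> rfl
  join_idem := by rintro ⟨⟩ <;> rfl
  join_comm := by rintro ⟨⟩ ⟨⟩ <;> rfl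
  join_assoc := by rintro ⟨⟩ ⟨⟩ ⟨⟩ <;> rfl
  meet_join := by rintro ⟨⟩ ⟨⟩ ⟨⟩ <;> rfl
  join_meet := by rintro ⟨⟩ ⟨⟩ ⟨⟩ <;> rfl
  neg_neg := by rintro ⟨⟩ <;> rfl
  neg_meet := by rintro ⟨⟩ ⟨⟩ <;> rfl
  neg_join := by rintro ⟨⟩ ⟨⟩ <;> rfl
  meet_join_self := by rintro ⟨⟩ ⟨⟩ <;> rfl
  join_meet_self := by rintro ⟨⟩ ⟨⟩ <;> rfl

end DM4

/-- A prime filter `P` of a De Morgan lattice yields the homomorphism to `DM₄` that records, for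
each `x`, whether `x` and `¬x` belong to `P`; prime filters separate points. -/
theorem valid_DML_of_satisfies_DM4 {φ ψ : dmLang.Term ℕ} (h : Satisfies DM4.alg φ ψ) :
    Valid DML.{u} φ ψ := by
  rintro A ⟨-, hA⟩ x
  let _ : DistribLattice A := hA.distribLattice
  have hsup : ∀ a b : A, join a b = a ⊔ b := fun _ _ => rfl
  have hinf : ∀ a b : A, meet a b = a ⊓ b := fun _ _ => rfl
  by_contra hne
  wlog hle : ¬ φ.realize x ≤ ψ.realize x generalizing φ ψ
  · exact this (fun x => (h x).symm) (Ne.symm hne) fun hle' =>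
      hne (le_antisymm (not_not.1 hle) hle')
  obtain ⟨J, hJ, hIJ, hdis⟩ := DistribLattice.prime_ideal_of_disjoint_filter_ideal
    (F := Order.PFilter.principal (φ.realize x)) (I := Order.Ideal.principal (ψ.realize x)) (by
      rw [Set.disjoint_left]
      intro y h1 h2
      exact hle (le_trans h1 h2))
  let g : A → DM4 := fun a => DM4.ofProps (a ∉ J) (neg a ∉ J)
  have hJsup : ∀ a b : A, a ⊔ b ∉ J ↔ a ∉ J ∨ b ∉ J := fun a b => by
    rw [Order.Ideal.sup_mem_iff, not_and_or]
  have hJinf : ∀ a b : A, a ⊓ b ∉ J ↔ a ∉ J ∧ b ∉ J := fun a b => by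
    rw [← not_or, not_iff_not]
    exact ⟨hJ.mem_or_mem, fun h => h.elim (J.lower inf_le_left) (J.lower inf_le_right)⟩
  have hg : ∀ χ : dmLang.Term ℕ, g (χ.realize x) = χ.realize (g ∘ x) := by
    intro χ
    induction χ using term_induction with
    | var n => rfl
    | meet s t hs ht =>
      rw [realize_tmeet, realize_tmeet, ← hs, ← ht]
      simp only [g]
      rw [hA.neg_meet, hinf, hsup, hJsup, hJinf, DM4.ofProps_inf]
    | join s t hs ht =>
      rw [realize_tjoin, realize_tjoin, ← hs, ← ht]
      simp only [g]
      rw [hA.neg_join, hinf, hsup, hJsup, hJinf, DM4.ofProps_sup]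
    | neg t ht =>
      rw [realize_tneg, realize_tneg, ← ht]
      simp only [g]
      rw [hA.neg_neg, DM4.ofProps_neg]
  have key : g (φ.realize x) = g (ψ.realize x) := by
    rw [hg, hg]; exact h _
  exact Set.disjoint_left.1 hdis (le_refl (φ.realize x))
    (not_not.1 fun hφ => (DM4.ofProps_inj key).1 hφ (hIJ (le_refl (ψ.realize x))))

theorem DM4.const_pi_mem_DML :
    (⟨PUnit.{u + 1} → DM4, piStructure fun _ => DM4.alg⟩ : Bundled.{u} dmLang.Structure) ∈
      DML.{u} := by
  have h := DM4.isDeMorganLattice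
  refine ⟨⟨fun _ => DM4.t⟩, ?_⟩
  let _ : dmLang.Structure (PUnit.{u + 1} → DM4) := piStructure fun _ => DM4.alg
  change IsDeMorganLattice (PUnit.{u + 1} → DM4)
  constructor
  · constructor
    · exact fun x => funext fun j => h.meet_idem (x j)
    · exact fun x y => funext fun j => h.meet_comm (x j) (y j)
    · exact fun x y z => funext fun j => h.meet_assoc (x j) (y j) (z j)
    · exact fun x => funext fun j => h.join_idem (x j)
    · exact fun x y => funext fun j => h.join_comm (x j) (y j)
    · exact fun x y z => funext fun j => h.join_assoc (x j) (y j) (z j)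
    · exact fun x y z => funext fun j => h.meet_join (x j) (y j) (z j)
    · exact fun x y z => funext fun j => h.join_meet (x j) (y j) (z j)
    · exact fun x => funext fun j => h.neg_neg (x j)
    · exact fun x y => funext fun j => h.neg_meet (x j) (y j)
    · exact fun x y => funext fun j => h.neg_join (x j) (y j)
  · exact fun x y => funext fun j => h.meet_join_self (x j) (y j)
  · exact fun x y => funext fun j => h.join_meet_self (x j) (y j)

/-- The De Morgan lattice `D × Dᵒᵈ` with the involution that exchanges the coordinates. -/
@[reducible] def swapStructure (D : Type u) [DistribLattice D] : dmLang.Structure (D × D) :=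
  mkDM (fun a b => (a.1 ⊓ b.1, a.2 ⊔ b.2)) (fun a b => (a.1 ⊔ b.1, a.2 ⊓ b.2)) Prod.swap

theorem swapStructure_mem_DML (D : Type u) [DistribLattice D] [Nonempty D] :
    (⟨D × D, swapStructure D⟩ : Bundled.{u} dmLang.Structure) ∈ DML.{u} := by
  refine ⟨inferInstanceAs (Nonempty (D × D)), ?_⟩
  let _ := swapStructure D
  change IsDeMorganLattice (D × D)
  constructor
  · constructor
    · exact fun x => Prod.ext (inf_idem x.1) (sup_idem x.2)
    · exact fun x y => Prod.ext (inf_comm x.1 y.1) (sup_comm x.2 y.2)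
    · exact fun x y z => Prod.ext (inf_assoc x.1 y.1 z.1) (sup_assoc x.2 y.2 z.2)
    · exact fun x => Prod.ext (sup_idem x.1) (inf_idem x.2)
    · exact fun x y => Prod.ext (sup_comm x.1 y.1) (inf_comm x.2 y.2)
    · exact fun x y z => Prod.ext (sup_assoc x.1 y.1 z.1) (inf_assoc x.2 y.2 z.2)
    · exact fun x y z => Prod.ext (inf_sup_left x.1 y.1 z.1) (sup_inf_left x.2 y.2 z.2)
    · exact fun x y z => Prod.ext (sup_inf_left x.1 y.1 z.1) (inf_sup_left x.2 y.2 z.2)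
    · exact fun x => rfl
    · exact fun x y => rfl
    · exact fun x y => rfl
  · exact fun x y => Prod.ext inf_sup_self sup_inf_self
  · exact fun x y => Prod.ext sup_inf_self inf_sup_self

end DeMorganLattices

/-! ### Identities of De Morgan–Płonka sums -/

namespace DirectSystem

variable {I : Type u} [InvolutiveSemilattice I] (F : DirectSystem I)

theorem p_meet (x y : Σ i, F.Fib i) {k : I} (h : x.1 ⊔ y.1 ≤ k) :
    F.p h (F.p le_sup_left x.2 ⊓ F.p le_sup_right y.2) =
      F.p (le_sup_left.trans h) x.2 ⊓ F.p (le_sup_right.trans h) y.2 := by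
  rw [map_inf, F.p_comp, F.p_comp]

theorem p_neg_meet (x y : Σ i, F.Fib i) {k : I} (h : inv (x.1 ⊔ y.1) ≤ k) :
    F.p h (F.n _ (F.p le_sup_left x.2 ⊓ F.p le_sup_right y.2)) =
      F.p ((inv_mono le_sup_left).trans h) (F.n _ x.2) ⊔
        F.p ((inv_mono le_sup_right).trans h) (F.n _ y.2) := by
  rw [F.n_inf, map_sup, F.n_p, F.n_p, F.p_comp, F.p_comp]

theorem p_join (x y : Σ i, F.Fib i) {k : I} (h : x.1 ⊔ y.1 ≤ k) :
    F.p h (F.p le_sup_left x.2 ⊔ F.p le_sup_right y.2) =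
      F.p (le_sup_left.trans h) x.2 ⊔ F.p (le_sup_right.trans h) y.2 := by
  rw [map_sup, F.p_comp, F.p_comp]

theorem p_neg_join (x y : Σ i, F.Fib i) {k : I} (h : inv (x.1 ⊔ y.1) ≤ k) :
    F.p h (F.n _ (F.p le_sup_left x.2 ⊔ F.p le_sup_right y.2)) =
      F.p ((inv_mono le_sup_left).trans h) (F.n _ x.2) ⊓
        F.p ((inv_mono le_sup_right).trans h) (F.n _ y.2) := by
  rw [F.n_sup, map_inf, F.n_p, F.n_p, F.p_comp, F.p_comp]

theorem p_congr {x y : Σ i, F.Fib i} (h : x = y) {k : I} (hx : x.1 ≤ k) (hy : y.1 ≤ k) :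
    F.p hx x.2 = F.p hy y.2 := by
  subst h; rfl

theorem realize_fst (x : ℕ → Σ i, F.Fib i) (φ : dmLang.Term ℕ) :
    (φ.realize x).1 = φ.realize fun n => (x n).1 := by
  induction φ using term_induction with
  | var n => rfl
  | meet s t hs ht => rw [realize_tmeet, realize_tmeet, ← hs, ← ht]; rfl
  | join s t hs ht => rw [realize_tjoin, realize_tjoin, ← hs, ← ht]; rfl
  | neg t ht => rw [realize_tneg, realize_tneg, ← ht]; rfl

open Classical in
/-- The assignment in `F(k) × F(k)ᵒᵈ` that carries both the value of `x` in `F(k)` and that of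
`¬x`, whenever they can be transported to `F(k)`; a coordinate that cannot be is arbitrary. -/
noncomputable def literals (k : I) (x : ℕ → Σ i, F.Fib i) (m : ℕ) : F.Fib k × F.Fib k :=
  (if h : (x m).1 ≤ k then F.p h (x m).2 else Classical.arbitrary _,
    if h : inv (x m).1 ≤ k then F.p h (F.n (x m).1 (x m).2) else Classical.arbitrary _)

theorem literals_fst {k : I} (x : ℕ → Σ i, F.Fib i) {m : ℕ} (h : (x m).1 ≤ k) :
    (F.literals k x m).1 = F.p h (x m).2 := dif_pos h

theorem literals_snd {k : I} (x : ℕ → Σ i, F.Fib i) {m : ℕ} (h : inv (x m).1 ≤ k) :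
    (F.literals k x m).2 = F.p h (F.n (x m).1 (x m).2) := dif_pos h

/-- Transported to `F(k)`, the value of a term and that of its negation are the coordinates of its
value in `F(k) × F(k)ᵒᵈ` at the literals. Both statements are needed together, since negation
exchanges them. -/
theorem p_realize (k : I) (x : ℕ → Σ i, F.Fib i) (φ : dmLang.Term ℕ) :
    letI := swapStructure (F.Fib k)
    (∀ h : (φ.realize x).1 ≤ k,
      F.p h (φ.realize x).2 = (φ.realize (F.literals k x)).1) ∧
    ∀ h : (neg (φ.realize x)).1 ≤ k,
      F.p h (neg (φ.realize x)).2 = (φ.realize (F.literals k x)).2 := by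
  let _ := swapStructure (F.Fib k)
  induction φ using term_induction with
  | var m =>
    refine ⟨fun h => ?_, fun h => ?_⟩
    · have h' : (x m).1 ≤ k := h
      exact (F.literals_fst x h').symm
    · have h' : inv (x m).1 ≤ k := h
      exact (F.literals_snd x h').symm
  | meet s t hs ht =>
    rw [realize_tmeet, realize_tmeet]
    constructor
    · intro h
      have h1 : (s.realize x).1 ≤ k := le_sup_left.trans h
      have h2 : (t.realize x).1 ≤ k := le_sup_right.trans h
      change _ = (s.realize (F.literals k x)).1 ⊓ (t.realize (F.literals k x)).1
      rw [← hs.1 h1, ← ht.1 h2]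
      exact F.p_meet _ _ h
    · intro h
      have h' : inv ((s.realize x).1 ⊔ (t.realize x).1) ≤ k := h
      have h1 : inv (s.realize x).1 ≤ k := (inv_mono le_sup_left).trans h'
      have h2 : inv (t.realize x).1 ≤ k := (inv_mono le_sup_right).trans h'
      change _ = (s.realize (F.literals k x)).2 ⊔ (t.realize (F.literals k x)).2
      rw [← hs.2 h1, ← ht.2 h2]
      exact F.p_neg_meet _ _ h'
  | join s t hs ht =>
    rw [realize_tjoin, realize_tjoin]
    constructor
    · intro h
      have h1 : (s.realize x).1 ≤ k := le_sup_left.trans h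
      have h2 : (t.realize x).1 ≤ k := le_sup_right.trans h
      change _ = (s.realize (F.literals k x)).1 ⊔ (t.realize (F.literals k x)).1
      rw [← hs.1 h1, ← ht.1 h2]
      exact F.p_join _ _ h
    · intro h
      have h' : inv ((s.realize x).1 ⊔ (t.realize x).1) ≤ k := h
      have h1 : inv (s.realize x).1 ≤ k := (inv_mono le_sup_left).trans h'
      have h2 : inv (t.realize x).1 ≤ k := (inv_mono le_sup_right).trans h'
      change _ = (s.realize (F.literals k x)).2 ⊓ (t.realize (F.literals k x)).2
      rw [← hs.2 h1, ← ht.2 h2]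
      exact F.p_neg_join _ _ h'
  | neg t ht =>
    rw [realize_tneg, realize_tneg]
    refine ⟨fun h => ht.2 h, fun h => ?_⟩
    have hnn : neg (neg (t.realize x)) = t.realize x := F.n_n _ _
    have h1 : (t.realize x).1 ≤ k := hnn ▸ h
    rw [F.p_congr hnn h h1]
    exact ht.1 h1

/-- An identity of De Morgan lattices holds in a De Morgan–Płonka sum as soon as it holds in
the involutive semilattice of indices. -/
theorem satisfies_sum {φ ψ : dmLang.Term ℕ} (hI : Satisfies (asDM I) φ ψ)
    (hD : Valid DML.{u} φ ψ) : Satisfies F.sum φ ψ := by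
  intro x
  change φ.realize x = ψ.realize x
  have hk : (φ.realize x).1 = (ψ.realize x).1 := by
    rw [realize_fst, realize_fst]
    exact hI _
  have h1 := (F.p_realize (φ.realize x).1 x φ).1 le_rfl
  have h2 := (F.p_realize (φ.realize x).1 x ψ).1 hk.ge
  have h3 := hD _ (swapStructure_mem_DML (F.Fib (φ.realize x).1))
    (F.literals (φ.realize x).1 x)
  have h4 : F.p le_rfl (φ.realize x).2 = F.p hk.ge (ψ.realize x).2 :=
    h1.trans ((congrArg Prod.fst h3).trans h2.symm)
  generalize φ.realize x = a at hk h4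
  generalize ψ.realize x = b at hk h4
  obtain ⟨i, a⟩ := a
  obtain ⟨j, b⟩ := b
  obtain rfl : i = j := hk
  rw [F.p_id, F.p_id] at h4
  exact congrArg (Sigma.mk i) h4

end DirectSystem

/-! ### The partition function of a De Morgan bisemilattice -/

local infixl:69 "⊓ₐ" => meet
local infixl:68 "⊔ₐ" => join
local prefix:max "¬ₐ" => neg

/-- Płonka's partition function `x ∧ (x ∨ b)`: in a Płonka sum it transports `x` to the fibre at
the join of the indices of `x` and `b`. -/
def proj {A : Type u} [dmLang.Structure A] (x b : A) : A := x ⊓ₐ (x ⊔ₐ b)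

namespace IsDeMorganBisemilattice

variable {A : Type u} [dmLang.Structure A]

theorem proj_eq_join (hA : IsDeMorganBisemilattice A) (x b : A) :
    proj x b = x ⊔ₐ (x ⊓ₐ b) := by
  rw [proj, hA.meet_join, hA.meet_idem]

theorem proj_self (hA : IsDeMorganBisemilattice A) (x : A) : proj x x = x := by
  rw [proj, hA.join_idem, hA.meet_idem]

theorem proj_trans (hA : IsDeMorganBisemilattice A) {a b c : A} (h1 : proj b a = b)
    (h2 : proj c b = c) : proj c a = c := by
  have h1' : b ⊔ₐ (b ⊓ₐ a) = b := (hA.proj_eq_join b a).symm.trans h1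
  have h2' : c ⊔ₐ (c ⊓ₐ b) = c := (hA.proj_eq_join c b).symm.trans h2
  calc c ⊓ₐ (c ⊔ₐ a) = (c ⊔ₐ (c ⊓ₐ b)) ⊓ₐ (c ⊔ₐ a) := by rw [h2']
    _ = (c ⊔ₐ (c ⊓ₐ b)) ⊔ₐ (c ⊓ₐ (b ⊓ₐ a)) := by rw [← hA.join_meet, h2', hA.meet_assoc]
    _ = c ⊔ₐ (c ⊓ₐ (b ⊔ₐ (b ⊓ₐ a))) := by rw [hA.meet_join c b, hA.join_assoc]
    _ = c := by rw [h1', h2']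

theorem proj_join_left (hA : IsDeMorganBisemilattice A) (a b : A) :
    proj (a ⊔ₐ b) a = a ⊔ₐ b := by
  rw [proj, hA.join_comm a b, hA.join_assoc, hA.join_idem, hA.meet_idem]

theorem proj_meet_left (hA : IsDeMorganBisemilattice A) (a b : A) :
    proj (a ⊓ₐ b) a = a ⊓ₐ b := by
  rw [hA.proj_eq_join, hA.meet_comm a b, hA.meet_assoc, hA.meet_idem, hA.join_idem]

theorem proj_eq_self_join (hA : IsDeMorganBisemilattice A) {a b c : A} (h1 : proj c a = c)
    (h2 : proj c b = c) : proj c (a ⊔ₐ b) = c := by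
  rw [hA.proj_eq_join, hA.meet_join, ← hA.join_assoc, ← hA.proj_eq_join, h1, ← hA.proj_eq_join,
    h2]

theorem proj_eq_self_meet (hA : IsDeMorganBisemilattice A) {a b c : A} (h1 : proj c a = c)
    (h2 : proj c b = c) : proj c (a ⊓ₐ b) = c := by
  rw [proj, hA.join_meet, ← hA.meet_assoc]
  exact (congrArg (· ⊓ₐ (c ⊔ₐ b)) h1).trans h2

theorem neg_proj (hA : IsDeMorganBisemilattice A) (x b : A) :
    ¬ₐ (proj x b) = proj (¬ₐ x) (¬ₐ b) := by
  rw [proj, hA.neg_meet, hA.neg_join, hA.proj_eq_join]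

theorem meet_proj (hA : IsDeMorganBisemilattice A) (x y b : A) :
    proj (x ⊓ₐ y) b = proj x b ⊓ₐ proj y b := by
  have := hA.meet_assoc
  have := hA.meet_comm
  rw [proj, proj, proj, hA.join_comm, hA.join_meet, hA.join_comm b, hA.join_comm b]
  grind

theorem join_proj (hA : IsDeMorganBisemilattice A) (x y b : A) :
    proj (x ⊔ₐ y) b = proj x b ⊔ₐ proj y b := by
  have := hA.join_assoc
  have := hA.join_comm
  rw [hA.proj_eq_join, hA.proj_eq_join, hA.proj_eq_join, hA.meet_comm, hA.meet_join,
    hA.meet_comm b, hA.meet_comm b]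
  grind

theorem proj_meet_join (hA : IsDeMorganBisemilattice A) (x b c : A) :
    proj x b ⊓ₐ (x ⊔ₐ (b ⊔ₐ c)) = proj x (b ⊔ₐ c) := by
  -- joins absorb the meets of their terms, although `s ∨ (s ∧ t) = s` may fail
  have hst : ∀ s t : A, (s ⊔ₐ t) ⊔ₐ (s ⊓ₐ t) = s ⊔ₐ t := fun s t => by
    rw [hA.join_meet, hA.join_comm (s ⊔ₐ t) s, ← hA.join_assoc, hA.join_idem, hA.join_assoc,
      hA.join_idem, hA.meet_idem]
  have h1 : proj x b ⊓ₐ (x ⊔ₐ (b ⊔ₐ c)) = x ⊓ₐ proj (x ⊔ₐ b) c := by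
    rw [proj, proj, hA.meet_assoc, hA.join_assoc]
  have h2 : x ⊓ₐ ((x ⊔ₐ b) ⊓ₐ c) = (x ⊓ₐ c) ⊔ₐ ((x ⊓ₐ b) ⊓ₐ (x ⊓ₐ c)) := by
    rw [← hA.meet_assoc, hA.meet_join, hA.meet_idem, hA.meet_comm _ c, hA.meet_join,
      hA.meet_comm c x, hA.meet_comm c, hA.meet_comm x c, ← hA.meet_assoc, hA.meet_comm (_ ⊓ₐ c),
      hA.meet_assoc, ← hA.meet_assoc x x, hA.meet_idem]
  rw [h1, hA.proj_eq_join, hA.meet_join, h2, hA.meet_join x x, hA.meet_idem, hA.proj_eq_join x,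
    hA.meet_join x b, hA.join_assoc, ← hA.join_assoc (x ⊓ₐ b), hst]

theorem proj_proj (hA : IsDeMorganBisemilattice A) (x b c : A) :
    proj (proj x b) c = proj x (b ⊔ₐ c) := by
  have h0 : proj x b ⊔ₐ c = (x ⊔ₐ (b ⊔ₐ c)) ⊓ₐ (x ⊔ₐ c) := by
    rw [proj, hA.join_comm, hA.join_meet, hA.join_comm c x, hA.join_comm c, hA.join_assoc,
      hA.meet_comm]
  have h1 : proj (proj x b) c = proj x b ⊓ₐ (x ⊔ₐ (b ⊔ₐ c)) ⊓ₐ (x ⊔ₐ c) := by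
    rw [hA.meet_assoc, ← h0]; rfl
  rw [h1, hA.proj_meet_join, hA.join_comm b c, ← hA.proj_meet_join x c b, proj,
    hA.meet_assoc, hA.meet_assoc, hA.meet_assoc, hA.meet_comm (x ⊔ₐ (c ⊔ₐ b)),
    ← hA.meet_assoc (x ⊔ₐ c), hA.meet_idem]

/-- Transport towards `b` is not affected by elements of fibres below that of `b`. -/
theorem proj_join_of_proj_eq (hA : IsDeMorganBisemilattice A) (x : A) {b c : A}
    (h : proj b c = b) : proj x (b ⊔ₐ c) = proj x b := by
  rw [← hA.proj_meet_join, proj, hA.meet_assoc, ← hA.join_meet]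
  exact congrArg (fun y => x ⊓ₐ (x ⊔ₐ y)) h

end IsDeMorganBisemilattice

/-! ### The De Morgan–Płonka decomposition -/

namespace IsDeMorganBisemilattice

variable {A : Type u} [dmLang.Structure A]

/-- A copy of `A`, preordered by comparing the fibres of elements: `b` lies in a fibre above
that of `a` when the partition function does not move `b` towards `a`. -/
def Carrier (_ : IsDeMorganBisemilattice A) : Type u := A

instance (hA : IsDeMorganBisemilattice A) : Preorder hA.Carrier where
  le a b := proj (A := A) b a = b
  le_refl := hA.proj_self
  le_trans _ _ _ := hA.proj_trans

/-- The index set of the Płonka decomposition. -/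
abbrev Index (hA : IsDeMorganBisemilattice A) : Type u :=
  Antisymmetrization hA.Carrier (· ≤ ·)

/-- The index of the fibre of an element. -/
def index (hA : IsDeMorganBisemilattice A) (a : A) : hA.Index :=
  toAntisymmetrization (α := hA.Carrier) (· ≤ ·) a

theorem index_le_index_iff (hA : IsDeMorganBisemilattice A) {a b : A} :
    hA.index a ≤ hA.index b ↔ proj b a = b :=
  Iff.rfl

theorem index_surjective (hA : IsDeMorganBisemilattice A) : Function.Surjective hA.index :=
  Quotient.mk_surjective

/-- A representative of an index. -/
noncomputable def rep (hA : IsDeMorganBisemilattice A) (i : hA.Index) : A :=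
  (hA.index_surjective i).choose

theorem index_rep (hA : IsDeMorganBisemilattice A) (i : hA.Index) : hA.index (hA.rep i) = i :=
  (hA.index_surjective i).choose_spec

theorem isLUB_index_join (hA : IsDeMorganBisemilattice A) (a b : A) :
    IsLUB {hA.index a, hA.index b} (hA.index (join a b)) := by
  constructor
  · rintro _ (rfl | rfl)
    · exact hA.proj_join_left a b
    · exact hA.join_comm a b ▸ hA.proj_join_left b a
  · intro k hk
    obtain ⟨c, rfl⟩ := hA.index_surjective k
    exact hA.proj_eq_self_join (hk (.inl rfl)) (hk (.inr rfl))

theorem isLUB_index_meet (hA : IsDeMorganBisemilattice A) (a b : A) :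
    IsLUB {hA.index a, hA.index b} (hA.index (meet a b)) := by
  constructor
  · rintro _ (rfl | rfl)
    · exact hA.proj_meet_left a b
    · exact hA.meet_comm a b ▸ hA.proj_meet_left b a
  · intro k hk
    obtain ⟨c, rfl⟩ := hA.index_surjective k
    exact hA.proj_eq_self_meet (hk (.inl rfl)) (hk (.inr rfl))

theorem index_neg_le (hA : IsDeMorganBisemilattice A) {a b : A}
    (h : hA.index a ≤ hA.index b) : hA.index (neg a) ≤ hA.index (neg b) := by
  rw [index_le_index_iff] at h ⊢
  rw [← hA.neg_proj, h]

noncomputable instance (hA : IsDeMorganBisemilattice A) : SemilatticeSup hA.Index where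
  sup i j := hA.index (join (hA.rep i) (hA.rep j))
  le_sup_left i j := by
    simpa only [index_rep] using (hA.isLUB_index_join (hA.rep i) (hA.rep j)).1 (.inl rfl)
  le_sup_right i j := by
    simpa only [index_rep] using (hA.isLUB_index_join (hA.rep i) (hA.rep j)).1 (.inr rfl)
  sup_le i j k hi hj := by
    refine (hA.isLUB_index_join (hA.rep i) (hA.rep j)).2 ?_
    rintro _ (rfl | rfl) <;> simpa only [index_rep]

theorem index_join (hA : IsDeMorganBisemilattice A) (a b : A) :
    hA.index (join a b) = hA.index a ⊔ hA.index b :=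
  (hA.isLUB_index_join a b).unique isLUB_pair

theorem index_meet (hA : IsDeMorganBisemilattice A) (a b : A) :
    hA.index (meet a b) = hA.index a ⊔ hA.index b :=
  (hA.isLUB_index_meet a b).unique isLUB_pair

theorem index_proj (hA : IsDeMorganBisemilattice A) (a b : A) :
    hA.index (proj a b) = hA.index a ⊔ hA.index b := by
  rw [proj, index_meet, index_join, ← sup_assoc, sup_idem]

theorem index_neg_rep (hA : IsDeMorganBisemilattice A) (a : A) :
    hA.index (neg (hA.rep (hA.index a))) = hA.index (neg a) :=
  (hA.index_neg_le (hA.index_rep _).le).antisymm (hA.index_neg_le (hA.index_rep _).ge)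

noncomputable instance (hA : IsDeMorganBisemilattice A) : InvolutiveSemilattice hA.Index where
  inv i := hA.index (neg (hA.rep i))
  inv_inv i := by
    rw [index_neg_rep, hA.neg_neg, index_rep]
  inv_sup i j := by
    obtain ⟨a, rfl⟩ := hA.index_surjective i
    obtain ⟨b, rfl⟩ := hA.index_surjective j
    rw [← index_join, index_neg_rep, index_neg_rep, index_neg_rep, hA.neg_join, index_meet]

theorem inv_index (hA : IsDeMorganBisemilattice A) (a : A) :
    inv (hA.index a) = hA.index (neg a) :=
  hA.index_neg_rep a

theorem fixesBipolar_index (hA : IsDeMorganBisemilattice A)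
    (h : ∀ x y : A, meet (meet x (join x (neg x))) (join (join x (neg x)) y) =
      meet (meet x (join x (neg x))) (join (join x (neg x)) (neg y))) :
    FixesBipolar hA.Index := by
  refine .of_sup fun c b => ?_
  obtain ⟨x, rfl⟩ := hA.index_surjective c
  obtain ⟨y, rfl⟩ := hA.index_surjective b
  have := congrArg hA.index (h x y)
  simpa only [index_meet, index_join, ← inv_index, ← sup_assoc, sup_idem, sup_right_comm] using this

/-- The fibre over `i` of the Płonka decomposition. -/
abbrev Fibre (hA : IsDeMorganBisemilattice A) (i : hA.Index) : Type u := {a : A // hA.index a = i}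

theorem sigma_fibre_ext (hA : IsDeMorganBisemilattice A) {s t : Σ i, hA.Fibre i}
    (h : s.2.1 = t.2.1) : s = t := by
  obtain ⟨i, a, rfl⟩ := s
  obtain ⟨j, b, rfl⟩ := t
  obtain rfl : a = b := h
  rfl

/-- Absorption holds between elements of the same fibre. -/
theorem proj_eq_of_index_eq (hA : IsDeMorganBisemilattice A) {a b : A}
    (h : hA.index a = hA.index b) : proj a b = a :=
  hA.index_le_index_iff.1 h.ge

theorem proj_congr (hA : IsDeMorganBisemilattice A) (x : A) {b c : A}
    (h : hA.index b = hA.index c) : proj x b = proj x c := by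
  rw [← hA.proj_join_of_proj_eq x (hA.proj_eq_of_index_eq h), hA.join_comm,
    hA.proj_join_of_proj_eq x (hA.proj_eq_of_index_eq h.symm)]

instance (hA : IsDeMorganBisemilattice A) (i : hA.Index) : DistribLattice (hA.Fibre i) :=
  let _ : Max (hA.Fibre i) := ⟨fun x y => ⟨join x.1 y.1, by rw [index_join, x.2, y.2, sup_idem]⟩⟩
  let _ : Min (hA.Fibre i) := ⟨fun x y => ⟨meet x.1 y.1, by rw [index_meet, x.2, y.2, sup_idem]⟩⟩
  let _ : Lattice (hA.Fibre i) := Lattice.mk'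
    (fun x y => Subtype.ext (hA.join_comm x.1 y.1))
    (fun x y z => Subtype.ext (hA.join_assoc x.1 y.1 z.1))
    (fun x y => Subtype.ext (hA.meet_comm x.1 y.1))
    (fun x y z => Subtype.ext (hA.meet_assoc x.1 y.1 z.1))
    (fun x y => Subtype.ext ((hA.proj_eq_join x.1 y.1).symm.trans
      (hA.proj_eq_of_index_eq (x.2.trans y.2.symm))))
    (fun x y => Subtype.ext (hA.proj_eq_of_index_eq (x.2.trans y.2.symm)))
  DistribLattice.ofInfSupLe fun x y z => le_of_eq (Subtype.ext (hA.meet_join x.1 y.1 z.1))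

/-- The Płonka decomposition of a De Morgan bisemilattice: transition maps are given by the
partition function, applied to any element of the target fibre. -/
noncomputable def directSystem (hA : IsDeMorganBisemilattice A) : DirectSystem hA.Index where
  Fib := hA.Fibre
  lattice _ := inferInstance
  nonempty i := ⟨⟨hA.rep i, hA.index_rep i⟩⟩
  p {i j} hij :=
    { toFun := fun x => ⟨proj x.1 (hA.rep j), by
        rw [index_proj, x.2, index_rep, sup_eq_right.2 hij]⟩
      map_sup' := fun x y => Subtype.ext (hA.join_proj x.1 y.1 _)
      map_inf' := fun x y => Subtype.ext (hA.meet_proj x.1 y.1 _) }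
  p_id i x := Subtype.ext (hA.proj_eq_of_index_eq (x.2.trans (hA.index_rep i).symm))
  p_comp {i j k} hij hjk x := by
    refine Subtype.ext ((hA.proj_proj x.1 _ _).trans (hA.proj_congr x.1 ?_))
    rw [index_join, index_rep, index_rep, sup_eq_right.2 hjk]
  n i x := ⟨neg x.1, by rw [← inv_index, x.2]⟩
  n_inf i x y := Subtype.ext (hA.neg_meet x.1 y.1)
  n_sup i x y := Subtype.ext (hA.neg_join x.1 y.1)
  n_n i x := hA.sigma_fibre_ext (hA.neg_neg x.1)
  n_p {i j} hij x := by
    refine Subtype.ext ((hA.neg_proj x.1 _).trans (hA.proj_congr _ ?_))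
    rw [← inv_index, index_rep, index_rep]

/-- A De Morgan bisemilattice is the De Morgan–Płonka sum of its decomposition. -/
noncomputable def equivSum (hA : IsDeMorganBisemilattice A) : A ≃[dmLang] hA.directSystem.sum where
  toFun a := ⟨hA.index a, a, rfl⟩
  invFun s := s.2.1
  left_inv _ := rfl
  right_inv _ := hA.sigma_fibre_ext rfl
  map_fun' {n} f x := by
    refine hA.sigma_fibre_ext ?_
    cases f with
    | meet =>
      have hx : Structure.funMap (L := dmLang) DMOp.meet x = meet (x 0) (x 1) :=
        congrArg _ (by funext i; fin_cases i <;> rfl)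
      change Structure.funMap (L := dmLang) DMOp.meet x =
        meet (proj (x 0) (hA.rep _)) (proj (x 1) (hA.rep _))
      rw [hx, ← hA.meet_proj, eq_comm]
      exact hA.proj_eq_of_index_eq ((hA.index_meet _ _).trans (hA.index_rep _).symm)
    | join =>
      have hx : Structure.funMap (L := dmLang) DMOp.join x = join (x 0) (x 1) :=
        congrArg _ (by funext i; fin_cases i <;> rfl)
      change Structure.funMap (L := dmLang) DMOp.join x =
        join (proj (x 0) (hA.rep _)) (proj (x 1) (hA.rep _))
      rw [hx, ← hA.join_proj, eq_comm]
      exact hA.proj_eq_of_index_eq ((hA.index_join _ _).trans (hA.index_rep _).symm)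
    | neg =>
      exact congrArg (Structure.funMap (L := dmLang) DMOp.neg) (by funext i; fin_cases i; rfl)
  map_rel' r := isEmptyElim r

end IsDeMorganBisemilattice

/-! ### Comparison of the four classes -/

theorem isDeMorganBisemilattice_of_involutiveSemilattice (I : Type u) [InvolutiveSemilattice I] :
    IsDeMorganBisemilattice I where
  meet_idem _ := sup_idem _
  meet_comm := sup_comm
  meet_assoc := sup_assoc
  join_idem _ := sup_idem _
  join_comm := sup_comm
  join_assoc := sup_assoc
  meet_join := sup_sup_distrib_left
  join_meet := sup_sup_distrib_left
  neg_neg := InvolutiveSemilattice.inv_inv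
  neg_meet := InvolutiveSemilattice.inv_sup
  neg_join := InvolutiveSemilattice.inv_sup

theorem FixesBipolar.asDM_mem_RBDMBL {I : Type u} [InvolutiveSemilattice I] [Nonempty I]
    (h : FixesBipolar I) : asDM I ∈ RBDMBL.{u} := by
  refine ⟨‹_›, isDeMorganBisemilattice_of_involutiveSemilattice I, fun x y => ?_⟩
  change x ⊔ (x ⊔ inv x) ⊔ (x ⊔ inv x ⊔ y) = x ⊔ (x ⊔ inv x) ⊔ (x ⊔ inv x ⊔ inv y)
  rw [sup_assoc x (inv x) y, h.sup_inv, ← sup_assoc x (inv x)]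

theorem DM4_mem_RBDMBL : DM4.alg ∈ RBDMBL.{0} :=
  ⟨⟨DM4.t⟩, DM4.isDeMorganLattice.toIsDeMorganBisemilattice, by rintro ⟨⟩ ⟨⟩ <;> rfl⟩

theorem generators_subset_RBDMBL :
    ({DM4.alg, asDM IS2, asDM IS3} : Set (Bundled.{0} dmLang.Structure)) ⊆ RBDMBL := by
  have : Nonempty IS2 := ⟨IS2.i⟩
  have : Nonempty IS3 := ⟨IS3.i⟩
  rintro _ (rfl | rfl | rfl)
  · exact DM4_mem_RBDMBL
  · exact fixesBipolar_IS2.asDM_mem_RBDMBL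
  · exact fixesBipolar_IS3.asDM_mem_RBDMBL

/-- The identities of the three generating algebras: those of `DM₄` are the ones of De Morgan
lattices, and those common to `IS₂` and `IS₃` are the regular bipolarly balanced ones. -/
theorem valid_generators_iff {φ ψ : dmLang.Term ℕ} :
    Valid {DM4.alg, asDM IS2, asDM IS3} φ ψ ↔
      IsRegularBipolarlyBalanced φ ψ ∧ Valid DML.{u} φ ψ := by
  constructor
  · intro h
    exact ⟨isRegularBipolarlyBalanced_of_satisfies (h _ (.inr (.inl rfl))) (h _ (.inr (.inr rfl))),
      valid_DML_of_satisfies_DM4 (h _ (.inl rfl))⟩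
  · rintro ⟨h1, h2⟩ _ (rfl | rfl | rfl)
    · exact satisfies_const_pi_iff.1 (h2 _ DM4.const_pi_mem_DML)
    · exact fixesBipolar_IS2.satisfies h1
    · exact fixesBipolar_IS3.satisfies h1

theorem RBip_subset_generatedVariety :
    RBip DML.{u} ⊆ generatedVariety {DM4.alg, asDM IS2, asDM IS3} := by
  rintro A ⟨hne, hA⟩
  exact mem_generatedVariety_of_satisfies fun φ ψ h =>
    hA φ ψ (valid_generators_iff.{u}.1 h).1 (valid_generators_iff.1 h).2

/-- Identities in three variables that hold throughout `RBDMBL` hold in `V(DM₄, IS₂, IS₃)`. -/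
theorem eq_of_mem_generatedVariety {A : Bundled.{u} dmLang.Structure}
    (hA : A ∈ generatedVariety {DM4.alg, asDM IS2, asDM IS3}) (φ ψ : dmLang.Term ℕ)
    (h : ∀ B : Bundled.{0} dmLang.Structure, B ∈ RBDMBL → Satisfies B φ ψ) (x y z : A) :
    φ.realize (fun n => if n = 0 then x else if n = 1 then y else z) =
      ψ.realize (fun n => if n = 0 then x else if n = 1 then y else z) :=
  satisfies_of_mem_generatedVariety (fun B hB => h B (generators_subset_RBDMBL hB)) hA _

theorem generatedVariety_subset_RBDMBL :
    generatedVariety {DM4.alg, asDM IS2, asDM IS3} ⊆ RBDMBL.{u} := by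
  intro A hA
  let x : dmLang.Term ℕ := Term.var 0
  let y : dmLang.Term ℕ := Term.var 1
  let z : dmLang.Term ℕ := Term.var 2
  have key := eq_of_mem_generatedVariety hA
  refine ⟨hA.1, ?_, fun a b => ?_⟩
  · constructor
    · exact fun a => by
        simpa [x] using key (tmeet x x) x (fun B hB v => by simpa using hB.2.1.meet_idem _) a a a
    · exact fun a b => by
        simpa [x, y] using key (tmeet x y) (tmeet y x)
          (fun B hB v => by simpa using hB.2.1.meet_comm _ _) a b a
    · exact fun a b c => by
        simpa [x, y, z] using key (tmeet (tmeet x y) z) (tmeet x (tmeet y z))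
          (fun B hB v => by simpa using hB.2.1.meet_assoc _ _ _) a b c
    · exact fun a => by
        simpa [x] using key (tjoin x x) x (fun B hB v => by simpa using hB.2.1.join_idem _) a a a
    · exact fun a b => by
        simpa [x, y] using key (tjoin x y) (tjoin y x)
          (fun B hB v => by simpa using hB.2.1.join_comm _ _) a b a
    · exact fun a b c => by
        simpa [x, y, z] using key (tjoin (tjoin x y) z) (tjoin x (tjoin y z))
          (fun B hB v => by simpa using hB.2.1.join_assoc _ _ _) a b c
    · exact fun a b c => by
        simpa [x, y, z] using key (tmeet x (tjoin y z)) (tjoin (tmeet x y) (tmeet x z))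
          (fun B hB v => by simpa using hB.2.1.meet_join _ _ _) a b c
    · exact fun a b c => by
        simpa [x, y, z] using key (tjoin x (tmeet y z)) (tmeet (tjoin x y) (tjoin x z))
          (fun B hB v => by simpa using hB.2.1.join_meet _ _ _) a b c
    · exact fun a => by
        simpa [x] using key (tneg (tneg x)) x
          (fun B hB v => by simpa using hB.2.1.neg_neg _) a a a
    · exact fun a b => by
        simpa [x, y] using key (tneg (tmeet x y)) (tjoin (tneg x) (tneg y))
          (fun B hB v => by simpa using hB.2.1.neg_meet _ _) a b a
    · exact fun a b => by
        simpa [x, y] using key (tneg (tjoin x y)) (tmeet (tneg x) (tneg y))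
          (fun B hB v => by simpa using hB.2.1.neg_join _ _) a b a
  · let s (t : dmLang.Term ℕ) : dmLang.Term ℕ :=
      tmeet (tmeet x (tjoin x (tneg x))) (tjoin (tjoin x (tneg x)) t)
    simpa [s, x, y] using key (s y) (s (tneg y))
      (fun B hB v => by simpa [s] using hB.2.2 _ _) a b a

theorem RBDMBL_subset_PlonkaSumsOver :
    RBDMBL.{u} ⊆ PlonkaSumsOver.{u} (generatedVariety {asIS IS2, asIS IS3}) := by
  rintro A ⟨⟨a⟩, hA, h⟩
  have : Nonempty hA.Index := ⟨hA.index a⟩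
  exact ⟨hA.Index, inferInstance, hA.directSystem,
    mem_generatedVariety_of_fixesBipolar (hA.fixesBipolar_index h), ⟨hA.equivSum⟩⟩

theorem PlonkaSumsOver_subset_RBip :
    PlonkaSumsOver.{u} (generatedVariety {asIS IS2, asIS IS3}) ⊆ RBip DML.{u} := by
  rintro A ⟨I, _, F, hI, ⟨e⟩⟩
  obtain ⟨i⟩ := hI.1
  refine ⟨⟨e.symm ⟨i, Classical.arbitrary _⟩⟩, fun φ ψ h hD x => e.injective ?_⟩
  rw [← HomClass.realize_term e, ← HomClass.realize_term e]
  exact F.satisfies_sum ((fixesBipolar_of_mem_generatedVariety hI).satisfies h) hD _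

/-- An identity valid in `R(Bip(DML))` holds in the three generating algebras, as powers of these
belong to `R(Bip(DML))`. -/
theorem valid_generators_of_valid_RBip {φ ψ : dmLang.Term ℕ} (h : Valid (RBip DML.{u}) φ ψ) :
    Valid {DM4.alg, asDM IS2, asDM IS3} φ ψ := by
  intro B hB
  have : Nonempty B := (generators_subset_RBDMBL hB).1
  exact satisfies_const_pi_iff.{u}.1 (h _ (PlonkaSumsOver_subset_RBip
    (RBDMBL_subset_PlonkaSumsOver (generatedVariety_subset_RBDMBL
      (const_pi_mem_generatedVariety hB)))))

end DeMorganPlonka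

theorem mainTheorem3 :
    -- the regular bipolarly balanced identities valid in `DML` are exactly the ones valid
    -- in `R(Bip(DML))`
    (∀ φ ψ : dmLang.Term ℕ,
      Valid (RBip DML.{u}) φ ψ ↔
        IsRegularBipolarlyBalanced φ ψ ∧
          Valid DML.{u} φ ψ) ∧
    -- the four classes coincide
    RBDMBL.{u} = RBip DML.{u} ∧
    RBip DML.{u} =
      generatedVariety
        {DM4.alg, asDM IS2,
          asDM IS3} ∧
    generatedVariety
        {DM4.alg, asDM IS2,
          asDM IS3} =
      PlonkaSumsOver.{u}
        (generatedVariety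
          {asIS IS2, asIS IS3}) := by
  have h12 : RBDMBL.{u} ⊆ RBip DML.{u} :=
    DeMorganPlonka.RBDMBL_subset_PlonkaSumsOver.trans DeMorganPlonka.PlonkaSumsOver_subset_RBip
  have h23 := DeMorganPlonka.RBip_subset_generatedVariety.{u}
  have h31 := DeMorganPlonka.generatedVariety_subset_RBDMBL.{u}
  have h14 := DeMorganPlonka.RBDMBL_subset_PlonkaSumsOver.{u}
  have h42 := DeMorganPlonka.PlonkaSumsOver_subset_RBip.{u}
  exact ⟨fun φ ψ => ⟨fun h => DeMorganPlonka.valid_generators_iff.1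
      (DeMorganPlonka.valid_generators_of_valid_RBip h), fun h A hA => hA.2 φ ψ h.1 h.2⟩,
    h12.antisymm (h23.trans h31), h23.antisymm (h31.trans h12),
    (h31.trans h14).antisymm (h42.trans h23)⟩
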